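/- **Setting.** A *self-similar system* $\Phi$ on a complete metric space $(X,d)$ is a finite set of maps $\varphi:X\to X$, each satisfying $d(\varphi(x),\varphi(y))=\lambda_\varphi\,d(x,y)$ for all $x,y\in X$, with a scaling ratio $\lambda_\varphi\in(0,1)$. Its scaling ratios are *arithmetically related* if the subgroup of the multiplicative group $(0,\infty)$ generated by $\{\lambda_\varphi\}_{\varphi\in\Phi}$ is discrete. Its *scaling zeta function* is the meromorphic function on $\mathbb C$ given by $\zeta_\Phi(s)=\bigl(1-\sum_{\varphi\in\Phi}\lambda_\varphi^{\,s}\bigr)^{-1}$. For $\delta>0$ and $R:(0,\infty)\to\mathbb R$ let $\zeta_R(s)=\zeta_R(s;\delta)=\int_0^\delta t^{s-1}R(t)\,dt$ be the truncated Mellin transform. Write $\mathbb H_a=\{s\in\mathbb C:\operatorname{Re}s>a\}$, $a\in[-\infty,\infty)$. A *screen* is a bounded Lipschitz function $S:\mathbb R\to\mathbb R$, identified with the curve $\{S(\tau)+i\tau:\tau\in\mathbb R\}$; its *window* is $W=\{s:\operatorname{Re}s\ge S(\operatorname{Im}s)\}$. A function $f$ *extends to* $S$ if it is holomorphic in some half-plane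 $\mathbb H_D\subseteq W$ and has an analytic continuation from there to a neighbourhood of $W$ minus a discrete set of singular points (with no accumulation point in the neighbourhood), none of them on the screen; the continuation is again denoted by $f$. *Admissible heights* are real numbers $(\tau_n)_{n\in\mathbb Z}$ with $\tau_n\to\pm\infty$ as $n\to\pm\infty$ and $\tau_{-n}<0<\tau_n$ for all $n\ge1$. Such an $f$ satisfies, with exponent $0$ and with respect to $S$, * **L1** with the heights $(\tau_n)$, if there are $C>0$ and $\beta>D$ such that for every $n\in\mathbb Z$ and $x\in[S(\tau_n),\beta]$, $f$ is holomorphic at $x+i\tau_n$ and $|f(x+i\tau_n)|\le C$; * **L2**, if there is $C>0$ such that $|f(S(\tau)+i\tau)|\le C$ for all $|\tau|\ge1$. Let $\zeta_R(\cdot;\delta)$ converge and be holomorphic in some right half-plane, and let $\mathbb H_{a}$ be the largest right half-plane to which both $\zeta_\Phi$ and $\zeta_R$ continue analytically up to a discrete set of singular points. A screen $S$ is *admissible* for $R$ and $\Phi$ (with truncation $\delta$) if it is contained in $\mathbb H_{a}$, both $\zeta_\Phi$ and $\zeta_R$ satisfy L1 with respect to $S$ with exponent $0$ and with one common sequence of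 admissible heights, and both satisfy L2 with respect to $S$ with exponent $0$. **Theorem (Lattice Criterion for Admissibility).** Let $\Phi$ be a self-similar system whose scaling ratios are arithmetically related, and let $R:(0,\infty)\to\mathbb R$ be continuous with $R(t)=O(t^{-\sigma_0})$ as $t\to0^+$, for some $\sigma_0\in\mathbb R$. Then for all but finitely many $\sigma>\sigma_0$ the constant screen $S_\sigma(\tau)\equiv\sigma$ is admissible for $R$ and $\Phi$, for every truncation $\delta>0$. Consequently, there is $\varepsilon_0>0$ such that for all $0<\varepsilon<\varepsilon_0$ the screen $S_{\sigma_0+\varepsilon}$ is admissible, for every $\delta>0$. -/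

import Mathlib

open Set Filter Topology MeasureTheory Asymptotics

noncomputable section

/-- A self-similar system on a metric space: a finite set of maps, each of which is a
similitude with scaling ratio in `(0, 1)`. (Values of `ratio` off `maps` are irrelevant.) -/
structure SelfSimilarSystem (X : Type*) [MetricSpace X] where
  maps : Finset (X → X)
  ratio : (X → X) → ℝ
  ratio_pos : ∀ φ ∈ maps, 0 < ratio φ
  ratio_lt_one : ∀ φ ∈ maps, ratio φ < 1
  dist_map : ∀ φ ∈ maps, ∀ x y : X, dist (φ x) (φ y) = ratio φ * dist x y

namespace SelfSimilarSystem

variable {X : Type*} [MetricSpace X]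

/-- The multiplicative group of positive reals generated by the scaling ratios. -/
def ratioGroup (Φ : SelfSimilarSystem X) : Subgroup {x : ℝ // 0 < x} :=
  Subgroup.closure {x | ∃ φ ∈ Φ.maps, (x : ℝ) = Φ.ratio φ}

/-- The lattice case: the group generated by the scaling ratios is discrete. -/
def ArithmeticallyRelated (Φ : SelfSimilarSystem X) : Prop :=
  DiscreteTopology Φ.ratioGroup

/-- The scaling zeta function `ζ_Φ(s) = 1 / (1 - ∑ λ_φ ^ s)`. (It is meromorphic on `ℂ`; the value
`0` which Lean gives it at a zero of the denominator is never used, see `ExtendsToScreen`.) -/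
def scalingZeta (Φ : SelfSimilarSystem X) (s : ℂ) : ℂ :=
  1 / (1 - ∑ φ ∈ Φ.maps, (Φ.ratio φ : ℂ) ^ s)

end SelfSimilarSystem

/-- The truncated Mellin transform `∫_0^δ t^(s-1) R(t) dt`. -/
def truncatedMellin (δ : ℝ) (R : ℝ → ℝ) (s : ℂ) : ℂ :=
  ∫ t in Ioc (0 : ℝ) δ, (t : ℂ) ^ (s - 1) * (R t : ℂ)

/-- The integral defining the truncated Mellin transform at `s` is (absolutely) convergent. -/
def TruncatedMellinConvergent (δ : ℝ) (R : ℝ → ℝ) (s : ℂ) : Prop :=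
  IntegrableOn (fun t : ℝ => (t : ℂ) ^ (s - 1) * (R t : ℂ)) (Ioc (0 : ℝ) δ)

/-- The open right half-plane `Re s > a`, where `a ∈ [-∞, ∞]`. -/
def halfPlane (a : EReal) : Set ℂ := {s | a < (s.re : EReal)}

/-- `F` is holomorphic on the open set `U` except for a set of singular points that is discrete
and has no accumulation point in `U`. -/
def HolomorphicOffDiscrete (F : ℂ → ℂ) (U : Set ℂ) : Prop :=
  ∀ z ∈ U, ∀ᶠ w in 𝓝[≠] z, AnalyticAt ℂ F w

/-- A screen is a bounded, Lipschitz continuous function `S : ℝ → ℝ`. -/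
def IsScreen (S : ℝ → ℝ) : Prop :=
  (∃ M : ℝ, ∀ τ, |S τ| ≤ M) ∧ ∃ K : NNReal, LipschitzWith K S

/-- The point `S(τ) + iτ` of the screen. -/
def screenPoint (S : ℝ → ℝ) (τ : ℝ) : ℂ := ⟨S τ, τ⟩

/-- The window associated to a screen. -/
def window (S : ℝ → ℝ) : Set ℂ := {s | S s.im ≤ s.re}

/-- `F` is an analytic continuation of `f`, given as a holomorphic function on the half-plane
`Re s > D`, to a neighbourhood of the window of `S`, with a discrete set of singular points,
none of which lies on the screen. The half-plane is contained in the window. -/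
structure ExtendsToScreen (f F : ℂ → ℂ) (D : ℝ) (S : ℝ → ℝ) : Prop where
  holomorphic : DifferentiableOn ℂ f (halfPlane D)
  eqOn : EqOn F f (halfPlane D)
  halfPlane_subset : halfPlane D ⊆ window S
  extends_window : ∃ U : Set ℂ, IsOpen U ∧ window S ⊆ U ∧ HolomorphicOffDiscrete F U
  analyticAt_screen : ∀ τ : ℝ, AnalyticAt ℂ F (screenPoint S τ)

/-- A sequence of admissible heights. -/
structure IsAdmissibleHeights (T : ℤ → ℝ) : Prop where
  tendsto_top : Tendsto T atTop atTop
  tendsto_bot : Tendsto T atBot atBot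
  pos : ∀ n : ℤ, 1 ≤ n → 0 < T n
  neg : ∀ n : ℤ, 1 ≤ n → T (-n) < 0

/-- Languidity hypothesis **L1** for `f` with exponent `κ`, with respect to the screen `S`, using
the sequence of heights `T`: no singular point lies on the contours `[S(τ_n), β] + i τ_n`, and the
continuation of `f` is at most `C (|τ_n| + 1) ^ κ` there. -/
def LanguidL1 (κ : ℝ) (f : ℂ → ℂ) (S : ℝ → ℝ) (T : ℤ → ℝ) : Prop :=
  IsAdmissibleHeights T ∧
  ∃ (F : ℂ → ℂ) (D : ℝ), ExtendsToScreen f F D S ∧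
    ∃ C > (0 : ℝ), ∃ β > D, ∀ n : ℤ, ∀ x ∈ Icc (S (T n)) β,
      AnalyticAt ℂ F ⟨x, T n⟩ ∧ ‖F ⟨x, T n⟩‖ ≤ C * (|T n| + 1) ^ κ

/-- Languidity hypothesis **L2** for `f` with exponent `κ`, with respect to the screen `S`. -/
def LanguidL2 (κ : ℝ) (f : ℂ → ℂ) (S : ℝ → ℝ) : Prop :=
  ∃ (F : ℂ → ℂ) (D : ℝ), ExtendsToScreen f F D S ∧
    ∃ C > (0 : ℝ), ∀ τ : ℝ, 1 ≤ |τ| → ‖F (screenPoint S τ)‖ ≤ C * |τ| ^ κ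

/-- `f`, which is holomorphic in some right half-plane, has an analytic continuation to the
half-plane `Re s > a`, except for a discrete set of singular points. -/
def ExtendsToHalfPlane (f : ℂ → ℂ) (a : EReal) : Prop :=
  ∃ (F : ℂ → ℂ) (D : ℝ), DifferentiableOn ℂ f (halfPlane D) ∧ EqOn F f (halfPlane D) ∧
    HolomorphicOffDiscrete F (halfPlane a)

/-- The abscissa in `[-∞, ∞)` of the half-plane of maximal joint extension of `f` and `g`: the
largest right half-plane to which both functions extend. -/
def maxJointAbscissa (f g : ℂ → ℂ) : EReal :=
  sInf {a : EReal | a < ⊤ ∧ ExtendsToHalfPlane f a ∧ ExtendsToHalfPlane g a}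

/-- `f` and `g` are jointly languid with exponent `κ` with respect to the screen `S`. -/
structure JointlyLanguid (κ : ℝ) (f g : ℂ → ℂ) (S : ℝ → ℝ) : Prop where
  holomorphic : ∃ σ₁ : ℝ,
    DifferentiableOn ℂ f (halfPlane σ₁) ∧ DifferentiableOn ℂ g (halfPlane σ₁)
  isScreen : IsScreen S
  screen_subset : ∀ τ : ℝ, screenPoint S τ ∈ halfPlane (maxJointAbscissa f g)
  languidL1 : ∃ T : ℤ → ℝ, LanguidL1 κ f S T ∧ LanguidL1 κ g S T
  languidL2 : LanguidL2 κ f S ∧ LanguidL2 κ g S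

/-- `S` is an admissible screen for the remainder `R` and the self-similar system `Φ`, where
`ζ_R` is the Mellin transform truncated at `δ`: this transform converges and is holomorphic in some
right half-plane, and `ζ_Φ` and `ζ_R` are jointly languid with exponent `0` with respect to `S`. -/
def IsAdmissibleScreen {X : Type*} [MetricSpace X] (δ : ℝ) (R : ℝ → ℝ)
    (Φ : SelfSimilarSystem X) (S : ℝ → ℝ) : Prop :=
  (∃ a : ℝ, (∀ s ∈ halfPlane a, TruncatedMellinConvergent δ R s) ∧
    DifferentiableOn ℂ (truncatedMellin δ R) (halfPlane a)) ∧
  JointlyLanguid 0 Φ.scalingZeta (truncatedMellin δ R) S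

end

/-!
In the lattice case the scaling ratios are integer powers of a single number, so the denominator
`1 - ∑ λ_φ ^ s` is an entire function with a purely imaginary period `i p`; it has no zeros far to
the right. Its zeros in a right half-plane therefore have, up to translation by `i p`, only finitely
many representatives, all in a compact rectangle, and so only finitely many vertical lines in the
half-plane carry poles of `ζ_Φ`. On any other line `ζ_Φ` is continuous and periodic, hence
bounded, which is **L2**. Some horizontal segment of bounded length misses all the poles, and
translating it by the multiples of `i p` gives the heights for **L1**. The transform `ζ_R` is
holomorphic to the right of `σ₀` and bounded on closed vertical strips there, so it satisfies both
conditions for every choice of heights.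
-/

section ScreensAndHalfPlanes

theorem mem_halfPlane_coe {a : ℝ} {s : ℂ} : s ∈ halfPlane a ↔ a < s.re :=
  EReal.coe_lt_coe_iff

theorem isOpen_halfPlane (a : EReal) : IsOpen (halfPlane a) :=
  isOpen_lt continuous_const (continuous_coe_real_ereal.comp Complex.continuous_re)

theorem antitone_halfPlane : Antitone halfPlane := fun _ _ hab _ hs => hab.trans_lt hs

theorem isScreen_const (σ : ℝ) : IsScreen fun _ => σ :=
  ⟨⟨|σ|, fun _ => le_rfl⟩, 0, LipschitzWith.const σ⟩

theorem holomorphicOffDiscrete_of_meromorphicOn {f : ℂ → ℂ} {U : Set ℂ} (hf : MeromorphicOn f U) :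
    HolomorphicOffDiscrete f U :=
  fun z hz => (hf z hz).eventually_analyticAt

theorem extendsToHalfPlane_of_meromorphicOn {f : ℂ → ℂ} {D : ℝ} {a : EReal}
    (hD : DifferentiableOn ℂ f (halfPlane D)) (hf : MeromorphicOn f (halfPlane a)) :
    ExtendsToHalfPlane f a :=
  ⟨f, D, hD, eqOn_refl f _, holomorphicOffDiscrete_of_meromorphicOn hf⟩

theorem maxJointAbscissa_le {f g : ℂ → ℂ} {a : ℝ} (hf : ExtendsToHalfPlane f a)
    (hg : ExtendsToHalfPlane g a) : maxJointAbscissa f g ≤ a :=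
  sInf_le ⟨EReal.coe_lt_top a, hf, hg⟩

theorem extendsToScreen_const_of_meromorphicOn {f : ℂ → ℂ} {a σ D : ℝ} (haσ : a < σ) (hσD : σ ≤ D)
    (hD : DifferentiableOn ℂ f (halfPlane D)) (hf : MeromorphicOn f (halfPlane a))
    (hfσ : ∀ s : ℂ, s.re = σ → AnalyticAt ℂ f s) :
    ExtendsToScreen f f D fun _ => σ where
  holomorphic := hD
  eqOn := eqOn_refl f _
  halfPlane_subset _ hs := hσD.trans (mem_halfPlane_coe.1 hs).le
  extends_window := ⟨halfPlane a, isOpen_halfPlane a,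
    fun _ hs => mem_halfPlane_coe.2 (haσ.trans_le hs), holomorphicOffDiscrete_of_meromorphicOn hf⟩
  analyticAt_screen _ := hfσ _ rfl

theorem ExtendsToScreen.languidL1_zero {f F : ℂ → ℂ} {S : ℝ → ℝ} {T : ℤ → ℝ} {D β C : ℝ}
    (hF : ExtendsToScreen f F D S) (hT : IsAdmissibleHeights T) (hβ : D < β)
    (han : ∀ n : ℤ, ∀ x ∈ Icc (S (T n)) β, AnalyticAt ℂ F ⟨x, T n⟩)
    (hC : ∀ n : ℤ, ∀ x ∈ Icc (S (T n)) β, ‖F ⟨x, T n⟩‖ ≤ C) :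
    LanguidL1 0 f S T :=
  ⟨hT, F, D, hF, max C 1, by positivity, β, hβ, fun n x hx => ⟨han n x hx, by
    simpa only [Real.rpow_zero, mul_one] using le_max_of_le_left (hC n x hx)⟩⟩

theorem ExtendsToScreen.languidL2_zero {f F : ℂ → ℂ} {S : ℝ → ℝ} {D C : ℝ}
    (hF : ExtendsToScreen f F D S) (hC : ∀ τ : ℝ, 1 ≤ |τ| → ‖F (screenPoint S τ)‖ ≤ C) :
    LanguidL2 0 f S :=
  ⟨F, D, hF, max C 1, by positivity, fun τ hτ => by
    simpa only [Real.rpow_zero, mul_one] using le_max_of_le_left (hC τ hτ)⟩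

theorem isAdmissibleHeights_add_intCast_mul {τ p : ℝ} (hτ : τ ∈ Ioo 0 p) :
    IsAdmissibleHeights fun n : ℤ => τ + n * p := by
  have hp : 0 < p := hτ.1.trans hτ.2
  refine ⟨?_, ?_, fun n hn => ?_, fun n hn => ?_⟩
  · exact tendsto_atTop_add_const_left _ _ (tendsto_intCast_atTop_atTop.atTop_mul_const hp)
  · exact tendsto_atBot_add_const_left _ _
      ((tendsto_intCast_atBot_iff.2 tendsto_id).atBot_mul_const hp)
  · have hn' : (0 : ℝ) ≤ n := by exact_mod_cast zero_le_one.trans hn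
    exact add_pos_of_pos_of_nonneg hτ.1 (mul_nonneg hn' hp.le)
  · have hn' : (1 : ℝ) ≤ n := by exact_mod_cast hn
    push_cast
    linarith [hτ.2, le_mul_of_one_le_left hp.le hn']

end ScreensAndHalfPlanes

section BoundedOnStrips

variable {h : ℂ → ℂ} {a σ : ℝ}

theorem analyticAt_of_differentiableOn_halfPlane (hh : DifferentiableOn ℂ h (halfPlane a)) {s : ℂ}
    (hs : a < s.re) : AnalyticAt ℂ h s :=
  hh.analyticAt ((isOpen_halfPlane a).mem_nhds (mem_halfPlane_coe.2 hs))

theorem meromorphicOn_halfPlane_of_differentiableOn (hh : DifferentiableOn ℂ h (halfPlane a)) :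
    MeromorphicOn h (halfPlane a) :=
  (hh.analyticOnNhd (isOpen_halfPlane a)).meromorphicOn

theorem extendsToScreen_const_of_differentiableOn (hh : DifferentiableOn ℂ h (halfPlane a))
    (hσ : a < σ) : ExtendsToScreen h h σ fun _ => σ :=
  extendsToScreen_const_of_meromorphicOn hσ le_rfl
    (hh.mono (antitone_halfPlane (EReal.coe_le_coe_iff.2 hσ.le)))
    (meromorphicOn_halfPlane_of_differentiableOn hh)
    fun _ hs => analyticAt_of_differentiableOn_halfPlane hh (hσ.trans_eq hs.symm)

theorem languidL1_const_of_bounded_on_strip (hh : DifferentiableOn ℂ h (halfPlane a)) (hσ : a < σ)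
    {β C : ℝ} (hβ : σ < β) (hC : ∀ s : ℂ, s.re ∈ Icc σ β → ‖h s‖ ≤ C)
    {T : ℤ → ℝ} (hT : IsAdmissibleHeights T) : LanguidL1 0 h (fun _ => σ) T :=
  (extendsToScreen_const_of_differentiableOn hh hσ).languidL1_zero hT hβ
    (fun _ _ hx => analyticAt_of_differentiableOn_halfPlane hh (hσ.trans_le hx.1))
    fun _ _ hx => hC _ hx

theorem languidL2_const_of_bounded_on_line (hh : DifferentiableOn ℂ h (halfPlane a)) (hσ : a < σ)
    {C : ℝ} (hC : ∀ s : ℂ, s.re = σ → ‖h s‖ ≤ C) : LanguidL2 0 h fun _ => σ :=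
  (extendsToScreen_const_of_differentiableOn hh hσ).languidL2_zero fun _ _ => hC _ rfl

end BoundedOnStrips

theorem finite_zeros_of_isCompact_of_differentiable {g : ℂ → ℂ} (hg : Differentiable ℂ g) {z : ℂ}
    (hz : g z ≠ 0) {K : Set ℂ} (hK : IsCompact K) : (K ∩ g ⁻¹' {0}).Finite := by
  have hzeros : g ⁻¹' {0}ᶜ ∈ codiscrete ℂ :=
    (Complex.analyticOnNhd_univ_iff_differentiable.2 hg).preimage_zero_mem_codiscrete hz
  simpa only [preimage_compl, sdiff_compl, inf_eq_inter] using
    hK.finite_sdiff_of_mem_codiscreteWithin (Filter.codiscreteWithin_mono (subset_univ K) hzeros)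

theorem exists_mem_Ioo_forall_ne_zero_of_differentiable {g : ℂ → ℂ} (hg : Differentiable ℂ g)
    {z : ℂ} (hz : g z ≠ 0) (a b : ℝ) {c d : ℝ} (hcd : c < d) :
    ∃ τ ∈ Ioo c d, ∀ x ∈ Icc a b, g ⟨x, τ⟩ ≠ 0 := by
  have hfin := finite_zeros_of_isCompact_of_differentiable hg hz
    ((isCompact_Icc (a := a) (b := b)).reProdIm (isCompact_Icc (a := c) (b := d)))
  obtain ⟨τ, hτ, hτ_im⟩ := (Ioo_infinite hcd).exists_notMem_finite (hfin.image Complex.im)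
  exact ⟨τ, hτ, fun x hx h0 => hτ_im ⟨⟨x, τ⟩, ⟨⟨hx, Ioo_subset_Icc_self hτ⟩, h0⟩, rfl⟩⟩

theorem continuous_complex_mk {α : Type*} [TopologicalSpace α] {u v : α → ℝ} (hu : Continuous u)
    (hv : Continuous v) : Continuous fun t => (⟨u t, v t⟩ : ℂ) :=
  Complex.equivRealProdCLM.symm.continuous.comp (hu.prodMk hv)

section ImaginaryPeriod

variable {g : ℂ → ℂ} {p D σ : ℝ}

theorem periodic_vertical_line (hp : Function.Periodic g (p * Complex.I)) (x : ℝ) :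
    Function.Periodic (fun τ : ℝ => g ⟨x, τ⟩) p := by
  intro τ
  have htranslate : (⟨x, τ + p⟩ : ℂ) = ⟨x, τ⟩ + p * Complex.I := by
    apply Complex.ext <;> simp
  simpa only [htranslate] using hp ⟨x, τ⟩

theorem finite_re_image_zeros_of_periodic (hg : Differentiable ℂ g) (hp₀ : 0 < p)
    (hp : Function.Periodic g (p * Complex.I)) (hD : ∀ s : ℂ, D < s.re → g s ≠ 0) (a : ℝ) :
    (Complex.re '' {s : ℂ | a ≤ s.re ∧ g s = 0}).Finite := by
  have hne : g ((D + 1 : ℝ) : ℂ) ≠ 0 := hD _ (lt_add_one D)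
  refine ((finite_zeros_of_isCompact_of_differentiable hg hne
    ((isCompact_Icc (a := a) (b := D)).reProdIm (isCompact_Icc (a := 0) (b := p)))).image
    Complex.re).subset ?_
  rintro _ ⟨s, ⟨has, hs⟩, rfl⟩
  have hsD : s.re ≤ D := not_lt.1 fun hDs => hD s hDs hs
  obtain ⟨τ, hτ, hτs⟩ := (periodic_vertical_line hp s.re).exists_mem_Ico₀ hp₀ s.im
  exact ⟨⟨s.re, τ⟩, ⟨⟨⟨has, hsD⟩, Ico_subset_Icc_self hτ⟩, hτs.symm.trans hs⟩, rfl⟩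

theorem differentiableOn_inv_halfPlane (hg : Differentiable ℂ g)
    (hD : ∀ s : ℂ, D < s.re → g s ≠ 0) : DifferentiableOn ℂ g⁻¹ (halfPlane D) :=
  hg.differentiableOn.inv fun s hs => hD s (mem_halfPlane_coe.1 hs)

theorem meromorphicOn_inv_of_differentiable (hg : Differentiable ℂ g) (U : Set ℂ) :
    MeromorphicOn g⁻¹ U :=
  fun z _ => (hg.analyticAt z).meromorphicAt.inv

theorem extendsToScreen_const_inv (hg : Differentiable ℂ g) (hD : ∀ s : ℂ, D < s.re → g s ≠ 0)
    (hσ : ∀ s : ℂ, s.re = σ → g s ≠ 0) :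
    ExtendsToScreen g⁻¹ g⁻¹ (max D σ : ℝ) fun _ => σ :=
  extendsToScreen_const_of_meromorphicOn (sub_one_lt σ) (le_max_right D σ)
    (differentiableOn_inv_halfPlane hg fun s hs => hD s ((le_max_left D σ).trans_lt hs))
    (meromorphicOn_inv_of_differentiable hg _) fun s hs => (hg.analyticAt s).inv (hσ s hs)

theorem exists_languidL1_const_inv_of_periodic (hg : Differentiable ℂ g)
    (hD : ∀ s : ℂ, D < s.re → g s ≠ 0) (hp₀ : 0 < p)
    (hp : Function.Periodic g (p * Complex.I)) (hσ : ∀ s : ℂ, s.re = σ → g s ≠ 0) :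
    ∃ T : ℤ → ℝ, LanguidL1 0 g⁻¹ (fun _ => σ) T := by
  set β := max D σ + 1
  obtain ⟨τ, hτ, hseg⟩ :=
    exists_mem_Ioo_forall_ne_zero_of_differentiable hg (hσ σ rfl) σ β hp₀
  have hper : ∀ (x : ℝ) (n : ℤ), g ⟨x, τ + n * p⟩ = g ⟨x, τ⟩ := fun x n =>
    (periodic_vertical_line hp x).int_mul n τ
  have hcont : Continuous fun x : ℝ => g ⟨x, τ⟩ :=
    hg.continuous.comp (continuous_complex_mk continuous_id continuous_const)
  obtain ⟨C, hC⟩ := isCompact_Icc.exists_bound_of_continuousOn (hcont.continuousOn.inv₀ hseg)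
  refine ⟨fun n => τ + n * p, (extendsToScreen_const_inv hg hD hσ).languidL1_zero (C := C)
    (isAdmissibleHeights_add_intCast_mul hτ) (lt_add_one _) (fun n x hx => ?_) fun n x hx => ?_⟩
  · exact (hg.analyticAt _).inv ((hper x n).trans_ne (hseg x hx))
  · simpa only [Pi.inv_apply, hper] using hC x hx

theorem languidL2_const_inv_of_periodic (hg : Differentiable ℂ g)
    (hD : ∀ s : ℂ, D < s.re → g s ≠ 0) (hp₀ : p ≠ 0)
    (hp : Function.Periodic g (p * Complex.I)) (hσ : ∀ s : ℂ, s.re = σ → g s ≠ 0) :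
    LanguidL2 0 g⁻¹ fun _ => σ := by
  have hcont : Continuous fun τ : ℝ => (g ⟨σ, τ⟩)⁻¹ :=
    (hg.continuous.comp (continuous_complex_mk continuous_const continuous_id)).inv₀
      fun _ => hσ _ rfl
  have hper : Function.Periodic (fun τ : ℝ => (g ⟨σ, τ⟩)⁻¹) p :=
    (periodic_vertical_line hp σ).comp (·⁻¹)
  obtain ⟨C, hC⟩ := (hper.isBounded_of_continuous hp₀ hcont).exists_norm_le
  exact (extendsToScreen_const_inv hg hD hσ).languidL2_zero fun τ _ => hC _ (mem_range_self τ)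

theorem jointlyLanguid_const_inv_of_periodic (hg : Differentiable ℂ g)
    (hD : ∀ s : ℂ, D < s.re → g s ≠ 0) (hp₀ : 0 < p)
    (hp : Function.Periodic g (p * Complex.I)) (hσ : ∀ s : ℂ, s.re = σ → g s ≠ 0)
    {h : ℂ → ℂ} {a β C : ℝ} (hh : DifferentiableOn ℂ h (halfPlane a)) (haσ : a < σ) (hβ : σ < β)
    (hC : ∀ s : ℂ, s.re ∈ Icc σ β → ‖h s‖ ≤ C) :
    JointlyLanguid 0 g⁻¹ h fun _ => σ := by
  have hg_inv : DifferentiableOn ℂ g⁻¹ (halfPlane D) := differentiableOn_inv_halfPlane hg hD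
  have habscissa : maxJointAbscissa g⁻¹ h ≤ a := maxJointAbscissa_le
    (extendsToHalfPlane_of_meromorphicOn hg_inv (meromorphicOn_inv_of_differentiable hg _))
    (extendsToHalfPlane_of_meromorphicOn hh (meromorphicOn_halfPlane_of_differentiableOn hh))
  obtain ⟨T, hT⟩ := exists_languidL1_const_inv_of_periodic hg hD hp₀ hp hσ
  exact
    { holomorphic := ⟨max D a,
        hg_inv.mono (antitone_halfPlane (EReal.coe_le_coe_iff.2 (le_max_left D a))),
        hh.mono (antitone_halfPlane (EReal.coe_le_coe_iff.2 (le_max_right D a)))⟩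
      isScreen := isScreen_const σ
      screen_subset := fun _ => habscissa.trans_lt (EReal.coe_lt_coe_iff.2 haσ)
      languidL1 := ⟨T, hT, languidL1_const_of_bounded_on_strip hh haσ hβ hC hT.1⟩
      languidL2 := ⟨languidL2_const_inv_of_periodic hg hD hp₀.ne' hp hσ,
        languidL2_const_of_bounded_on_line hh haσ fun s hs => hC s ⟨hs.ge, hs.trans_le hβ.le⟩⟩ }

end ImaginaryPeriod

section LatticeCase

instance instOrderTopologyPositive {K : Type*} [Zero K] [LinearOrder K] [TopologicalSpace K]
    [OrderTopology K] : OrderTopology {x : K // 0 < x} :=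
  orderTopology_of_ordConnected (t := Ioi (0 : K))

instance instMulArchimedeanPositive {K : Type*} [CommSemiring K] [LinearOrder K]
    [IsStrictOrderedRing K] [ExistsAddOfLE K] [Archimedean K] :
    MulArchimedean {x : K // 0 < x} where
  arch x _ hy := (pow_unbounded_of_one_lt (x : K) hy).imp fun _ hn => hn.le

theorem periodic_ofReal_cpow {x p : ℝ} (hx : 0 < x) {k : ℤ}
    (hk : Real.log x * p = k * (2 * Real.pi)) :
    Function.Periodic (fun s : ℂ => (x : ℂ) ^ s) (p * Complex.I) := by
  have hx₀ : (x : ℂ) ≠ 0 := Complex.ofReal_ne_zero.2 hx.ne'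
  have hexp : Complex.log x * (p * Complex.I) = k * (2 * Real.pi * Complex.I) := by
    rw [← Complex.ofReal_log hx.le, ← mul_assoc, ← mul_assoc]
    exact_mod_cast congrArg (fun y : ℝ => (y : ℂ) * Complex.I) hk
  intro s
  simp only [Complex.cpow_add _ _ hx₀, Complex.cpow_def_of_ne_zero hx₀ (p * Complex.I), hexp,
    Complex.exp_int_mul_two_pi_mul_I, mul_one]

namespace SelfSimilarSystem

variable {X : Type*} [MetricSpace X] (Φ : SelfSimilarSystem X)

/-- The Dirichlet polynomial `1 - ∑ λ_φ ^ s`, whose reciprocal is the scaling zeta function. -/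
noncomputable def scalingDenominator (s : ℂ) : ℂ :=
  1 - ∑ φ ∈ Φ.maps, (Φ.ratio φ : ℂ) ^ s

theorem scalingZeta_eq_inv : Φ.scalingZeta = Φ.scalingDenominator⁻¹ :=
  funext fun _ => one_div _

theorem differentiable_scalingDenominator : Differentiable ℂ Φ.scalingDenominator :=
  (differentiable_const 1).sub <| Differentiable.fun_sum fun φ hφ =>
    differentiable_id.const_cpow (Or.inl (Complex.ofReal_ne_zero.2 (Φ.ratio_pos φ hφ).ne'))

theorem exists_forall_scalingDenominator_ne_zero :
    ∃ D : ℝ, ∀ s : ℂ, D < s.re → Φ.scalingDenominator s ≠ 0 := by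
  have hlim : Tendsto (fun x : ℝ => ∑ φ ∈ Φ.maps, Φ.ratio φ ^ x) atTop (𝓝 0) := by
    simpa only [Finset.sum_const_zero] using tendsto_finsetSum Φ.maps fun φ hφ =>
      tendsto_rpow_atTop_of_base_lt_one (Φ.ratio φ) (by linarith [Φ.ratio_pos φ hφ])
        (Φ.ratio_lt_one φ hφ)
  obtain ⟨D, hD⟩ := eventually_atTop.1 (hlim.eventually_lt_const one_pos)
  refine ⟨D, fun s hs => sub_ne_zero.2 fun hone => ?_⟩
  have hlt : ‖∑ φ ∈ Φ.maps, (Φ.ratio φ : ℂ) ^ s‖ < 1 :=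
    (norm_sum_le_of_le _ fun φ hφ =>
      (Complex.norm_cpow_eq_rpow_re_of_pos (Φ.ratio_pos φ hφ) s).le).trans_lt (hD s.re hs.le)
  rw [← hone, norm_one] at hlt
  exact hlt.false

variable {Φ}

theorem ArithmeticallyRelated.exists_pos_forall_log_ratio_eq (hΦ : Φ.ArithmeticallyRelated) :
    ∃ c > 0, ∀ φ ∈ Φ.maps, ∃ k : ℤ, Real.log (Φ.ratio φ) = k * c := by
  obtain ⟨⟨g, hg₀⟩, hg⟩ := (Subgroup.isCyclic_iff_exists_zpowers_eq_top _).1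
    (Subgroup.discrete_iff_cyclic.2 hΦ)
  have hlog : ∀ φ ∈ Φ.maps, ∃ k : ℤ, Real.log (Φ.ratio φ) = k * Real.log g := by
    intro φ hφ
    have hmem : (⟨Φ.ratio φ, Φ.ratio_pos φ hφ⟩ : {x : ℝ // 0 < x}) ∈ Φ.ratioGroup :=
      Subgroup.subset_closure ⟨φ, hφ, rfl⟩
    obtain ⟨k, hk⟩ := Subgroup.mem_zpowers_iff.1 (hg.ge hmem)
    exact ⟨k, by
      rw [← Real.log_zpow]
      exact congrArg (fun y : {x : ℝ // 0 < x} => Real.log y) hk.symm⟩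
  rcases lt_trichotomy (Real.log g) 0 with hneg | hzero | hpos
  · exact ⟨-Real.log g, neg_pos.2 hneg, fun φ hφ => (hlog φ hφ).elim fun k hk =>
      ⟨-k, by rw [hk]; push_cast; ring⟩⟩
  · exact ⟨1, one_pos, fun φ hφ => (hlog φ hφ).elim fun k hk => ⟨0, by simp [hk, hzero]⟩⟩
  · exact ⟨Real.log g, hpos, hlog⟩

theorem ArithmeticallyRelated.exists_pos_periodic_scalingDenominator
    (hΦ : Φ.ArithmeticallyRelated) :
    ∃ p : ℝ, 0 < p ∧ Function.Periodic Φ.scalingDenominator (p * Complex.I) := by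
  obtain ⟨c, hc, hlog⟩ := hΦ.exists_pos_forall_log_ratio_eq
  refine ⟨2 * Real.pi / c, by positivity, fun s => ?_⟩
  refine congrArg (1 - ·) (Finset.sum_congr rfl fun φ hφ => ?_)
  obtain ⟨k, hk⟩ := hlog φ hφ
  exact periodic_ofReal_cpow (Φ.ratio_pos φ hφ) (k := k) (by rw [hk]; field_simp) s

end SelfSimilarSystem

end LatticeCase

section MellinTransform

theorem rpow_le_rpow_add_rpow {t x a b : ℝ} (ht : 0 < t) (hx : x ∈ Icc a b) :
    t ^ x ≤ t ^ a + t ^ b := by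
  rcases le_total t 1 with ht₁ | ht₁
  · exact (Real.rpow_le_rpow_of_exponent_ge ht ht₁ hx.1).trans
      (le_add_of_nonneg_right (Real.rpow_nonneg ht.le b))
  · exact (Real.rpow_le_rpow_of_exponent_le ht₁ hx.2).trans
      (le_add_of_nonneg_left (Real.rpow_nonneg ht.le a))

theorem exists_forall_norm_mellin_le_on_strip {E : Type*} [NormedAddCommGroup E] [NormedSpace ℂ E]
    {f : ℝ → E} {a b : ℝ} (ha : MellinConvergent f a) (hb : MellinConvergent f b) :
    ∃ C : ℝ, ∀ s : ℂ, s.re ∈ Icc a b → ‖mellin f s‖ ≤ C := by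
  refine ⟨_, fun s hs => norm_integral_le_of_norm_le (ha.norm.add hb.norm) <|
    (ae_restrict_iff' measurableSet_Ioi).2 <| Eventually.of_forall fun t ht => ?_⟩
  have hnorm : ∀ z : ℂ, ‖(t : ℂ) ^ (z - 1) • f t‖ = t ^ (z.re - 1) * ‖f t‖ := fun z => by
    rw [norm_smul, Complex.norm_cpow_eq_rpow_re_of_pos ht, Complex.sub_re, Complex.one_re]
  simp only [Pi.add_apply, hnorm, Complex.ofReal_re, ← add_mul]
  exact mul_le_mul_of_nonneg_right (rpow_le_rpow_add_rpow ht
    ⟨sub_le_sub_right hs.1 1, sub_le_sub_right hs.2 1⟩) (norm_nonneg _)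

/-- The restriction of `R` to `(0, δ]`, extended by zero and viewed as complex-valued: its full
Mellin transform, to which Mathlib's theory applies, is the truncated Mellin transform of `R`. -/
noncomputable def truncation (δ : ℝ) (R : ℝ → ℝ) : ℝ → ℂ :=
  (Ioc 0 δ).indicator fun t => (R t : ℂ)

variable {σ₀ : ℝ} {R : ℝ → ℝ}

theorem truncatedMellin_eq_mellin_truncation (δ : ℝ) (R : ℝ → ℝ) :
    truncatedMellin δ R = mellin (truncation δ R) := by
  funext s
  simp_rw [truncatedMellin, mellin, truncation, ← indicator_smul]
  rw [setIntegral_indicator measurableSet_Ioc, inter_eq_right.2 Ioc_subset_Ioi_self]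
  rfl

theorem truncatedMellinConvergent_iff_mellinConvergent {δ : ℝ} {s : ℂ} :
    TruncatedMellinConvergent δ R s ↔ MellinConvergent (truncation δ R) s := by
  simp_rw [MellinConvergent, truncation, ← indicator_smul]
  rw [IntegrableOn, integrable_indicator_iff measurableSet_Ioc, IntegrableOn,
    Measure.restrict_restrict_of_subset Ioc_subset_Ioi_self]
  rfl

theorem locallyIntegrableOn_truncation (hR : LocallyIntegrableOn R (Ioi 0)) (δ : ℝ) :
    LocallyIntegrableOn (truncation δ R) (Ioi 0) := by
  intro t ht
  obtain ⟨u, hu, hRu⟩ := hR t ht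
  exact ⟨u, hu, hRu.ofReal.indicator measurableSet_Ioc⟩

theorem truncation_eventuallyEq_zero (δ : ℝ) (R : ℝ → ℝ) : truncation δ R =ᶠ[atTop] 0 := by
  filter_upwards [eventually_gt_atTop δ] with t ht
  exact indicator_of_notMem (fun hmem => hmem.2.not_gt ht) _

theorem truncation_isBigO_rpow_atTop (δ : ℝ) (R : ℝ → ℝ) (a : ℝ) :
    truncation δ R =O[atTop] fun t : ℝ => t ^ (-a) :=
  (truncation_eventuallyEq_zero δ R).trans_isBigO (isBigO_zero _ _)

theorem truncation_isBigO {l : Filter ℝ} (δ : ℝ) (R : ℝ → ℝ) : truncation δ R =O[l] R :=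
  isBigO_of_le l fun t => (norm_indicator_le_norm_self _ t).trans_eq (Complex.norm_real _)

theorem mellinConvergent_truncation (hR : LocallyIntegrableOn R (Ioi 0))
    (hRO : R =O[𝓝[>] (0 : ℝ)] fun t : ℝ => t ^ (-σ₀)) (δ : ℝ) {s : ℂ} (hs : σ₀ < s.re) :
    MellinConvergent (truncation δ R) s :=
  mellinConvergent_of_isBigO_rpow (locallyIntegrableOn_truncation hR δ)
    (truncation_isBigO_rpow_atTop δ R (s.re + 1)) (lt_add_one _)
    ((truncation_isBigO δ R).trans hRO) hs

theorem differentiableOn_truncatedMellin (hR : LocallyIntegrableOn R (Ioi 0))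
    (hRO : R =O[𝓝[>] (0 : ℝ)] fun t : ℝ => t ^ (-σ₀)) (δ : ℝ) :
    DifferentiableOn ℂ (truncatedMellin δ R) (halfPlane σ₀) := by
  intro s hs
  rw [truncatedMellin_eq_mellin_truncation]
  exact (mellin_differentiableAt_of_isBigO_rpow (locallyIntegrableOn_truncation hR δ)
    (truncation_isBigO_rpow_atTop δ R (s.re + 1)) (lt_add_one _)
    ((truncation_isBigO δ R).trans hRO) (mem_halfPlane_coe.1 hs)).differentiableWithinAt

theorem exists_forall_norm_truncatedMellin_le_on_strip (hR : LocallyIntegrableOn R (Ioi 0))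
    (hRO : R =O[𝓝[>] (0 : ℝ)] fun t : ℝ => t ^ (-σ₀)) (δ : ℝ) {a b : ℝ} (ha : σ₀ < a)
    (hb : σ₀ < b) : ∃ C : ℝ, ∀ s : ℂ, s.re ∈ Icc a b → ‖truncatedMellin δ R s‖ ≤ C := by
  rw [truncatedMellin_eq_mellin_truncation]
  exact exists_forall_norm_mellin_le_on_strip (mellinConvergent_truncation hR hRO δ ha)
    (mellinConvergent_truncation hR hRO δ hb)

end MellinTransform

section Admissibility

variable {X : Type*} [MetricSpace X] {Φ : SelfSimilarSystem X} {R : ℝ → ℝ} {σ₀ : ℝ}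

theorem isAdmissibleScreen_const (hΦ : Φ.ArithmeticallyRelated)
    (hR : LocallyIntegrableOn R (Ioi 0)) (hRO : R =O[𝓝[>] (0 : ℝ)] fun t : ℝ => t ^ (-σ₀))
    (δ : ℝ) {σ : ℝ} (hσ : σ₀ < σ) (hne : ∀ s : ℂ, s.re = σ → Φ.scalingDenominator s ≠ 0) :
    IsAdmissibleScreen δ R Φ fun _ => σ := by
  have hMellin := differentiableOn_truncatedMellin hR hRO δ
  refine ⟨⟨σ₀, fun s hs => truncatedMellinConvergent_iff_mellinConvergent.2
    (mellinConvergent_truncation hR hRO δ (mem_halfPlane_coe.1 hs)), hMellin⟩, ?_⟩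
  obtain ⟨D, hD⟩ := Φ.exists_forall_scalingDenominator_ne_zero
  obtain ⟨p, hp₀, hp⟩ := hΦ.exists_pos_periodic_scalingDenominator
  obtain ⟨C, hC⟩ := exists_forall_norm_truncatedMellin_le_on_strip hR hRO δ hσ
    (hσ.trans (lt_add_one σ))
  rw [Φ.scalingZeta_eq_inv]
  exact jointlyLanguid_const_inv_of_periodic Φ.differentiable_scalingDenominator hD hp₀ hp hne
    hMellin hσ (lt_add_one σ) hC

theorem finite_not_isAdmissibleScreen_const (hΦ : Φ.ArithmeticallyRelated)
    (hR : LocallyIntegrableOn R (Ioi 0)) (hRO : R =O[𝓝[>] (0 : ℝ)] fun t : ℝ => t ^ (-σ₀)) :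
    {σ : ℝ | σ₀ < σ ∧ ¬ ∀ δ > (0 : ℝ), IsAdmissibleScreen δ R Φ (fun _ => σ)}.Finite := by
  obtain ⟨D, hD⟩ := Φ.exists_forall_scalingDenominator_ne_zero
  obtain ⟨p, hp₀, hp⟩ := hΦ.exists_pos_periodic_scalingDenominator
  refine (finite_re_image_zeros_of_periodic Φ.differentiable_scalingDenominator hp₀ hp hD
    σ₀).subset fun σ ⟨hσ, hnot⟩ => ?_
  by_contra hpole
  refine hnot fun δ _ => isAdmissibleScreen_const hΦ hR hRO δ hσ fun s hs h0 => ?_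
  exact hpole ⟨s, ⟨(hσ.trans_eq hs.symm).le, h0⟩, hs⟩

end Admissibility

theorem eventually_nhdsGT_of_finite_exceptions {α : Type*} [Preorder α] [TopologicalSpace α]
    [T1Space α] {a : α} {P : α → Prop} (hP : {x | a < x ∧ ¬ P x}.Finite) :
    ∀ᶠ x in 𝓝[>] a, P x := by
  have hnhds : {x | a < x ∧ ¬ P x}ᶜ ∈ 𝓝 a :=
    hP.isClosed.compl_mem_nhds fun ha => lt_irrefl a ha.1
  filter_upwards [mem_nhdsWithin_of_mem_nhds hnhds, self_mem_nhdsWithin] with x hx hax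
  exact of_not_not fun hPx => hx ⟨hax, hPx⟩

theorem mainTheorem12_general {X : Type*} [MetricSpace X]
    (Φ : SelfSimilarSystem X) (hΦ : Φ.ArithmeticallyRelated)
    (R : ℝ → ℝ) (hR : LocallyIntegrableOn R (Ioi 0)) (σ₀ : ℝ)
    (hRO : R =O[𝓝[>] (0 : ℝ)] fun t : ℝ => t ^ (-σ₀)) :
    {σ : ℝ | σ₀ < σ ∧ ¬ ∀ δ > (0 : ℝ), IsAdmissibleScreen δ R Φ (fun _ => σ)}.Finite ∧
    ∃ ε₀ > (0 : ℝ), ∀ ε : ℝ, 0 < ε → ε < ε₀ →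
      ∀ δ > (0 : ℝ), IsAdmissibleScreen δ R Φ (fun _ => σ₀ + ε) := by
  have hfin := finite_not_isAdmissibleScreen_const hΦ hR hRO
  refine ⟨hfin, ?_⟩
  obtain ⟨u, hu, hadm⟩ :=
    mem_nhdsGT_iff_exists_Ioo_subset.1 (eventually_nhdsGT_of_finite_exceptions hfin)
  exact ⟨u - σ₀, sub_pos.2 hu, fun ε hε hεu =>
    hadm ⟨lt_add_of_pos_right σ₀ hε, lt_sub_iff_add_lt'.1 hεu⟩⟩

theorem mainTheorem12 {X : Type*} [MetricSpace X] [CompleteSpace X]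
    (Φ : SelfSimilarSystem X) (hΦ : Φ.ArithmeticallyRelated)
    (R : ℝ → ℝ) (hR : ContinuousOn R (Ioi 0)) (σ₀ : ℝ)
    (hRO : R =O[𝓝[>] (0 : ℝ)] fun t : ℝ => t ^ (-σ₀)) :
    {σ : ℝ | σ₀ < σ ∧ ¬ ∀ δ > (0 : ℝ), IsAdmissibleScreen δ R Φ (fun _ => σ)}.Finite ∧
    ∃ ε₀ > (0 : ℝ), ∀ ε : ℝ, 0 < ε → ε < ε₀ →
      ∀ δ > (0 : ℝ), IsAdmissibleScreen δ R Φ (fun _ => σ₀ + ε) :=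
  mainTheorem12_general Φ hΦ R (hR.locallyIntegrableOn measurableSet_Ioi) σ₀ hRO
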